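/- Let $K$ be a field with a valuation $\nu$, let $\overline{K}$ be an algebraic closure of $K$, and let $K(x)$ and $\overline{K}(x)$ be the rational function fields in one variable. Let $\omega$ be an extension of $\nu$ to $K(x)$ which is valuation transcendental, that is, either the $\mathbb{Q}$-vector space $(\omega K(x)/\nu K)\otimes_{\mathbb{Z}}\mathbb{Q}$ has dimension $1$ or the residue field $K(x)\omega$ has transcendence degree $1$ over the residue field $K\nu$. Let $\overline{\nu}$ be an extension of $\nu$ to $\overline{K}$. Valuations are considered up to equivalence. Then there are only finitely many valuations on $\overline{K}(x)$ that extend both $\omega$ and $\overline{\nu}$. More precisely, there are at most $[K(a):K]$ of them whenever $(a,\gamma)$ is a minimal pair of definition for $\omega$ with respect to $\overline{\nu}$. Here, for $a\in\overline{K}$ and $\gamma$ in an ordered abelian group containing $\overline{\nu}\,\overline{K}$, the valuation $\overline{\nu}_{a,\gamma}$ on $\overline{K}(x)$ is given on polynomials by $\overline{\nu}_{a,\gamma}\bigl(\sum_i c_i(x-a)^i\bigr)=\min_i(\overline{\nu}c_i+i\gamma)$ with $c_i\in\overline{K}$. The pair $(a,\gamma)$ is a pair of definition for $\omega$ if $\overline{\nu}_{a,\gamma}$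 restricts to $\omega$ on $K(x)$ (so it is a common extension of $\omega$ and $\overline{\nu}$). It is a minimal pair of definition if, moreover, $[K(a):K]\le[K(b):K]$ for every $b\in\overline{K}$ with $\overline{\nu}(a-b)\ge\gamma$. -/

import Mathlib

open Polynomial
open scoped TensorProduct

noncomputable section

namespace ValTransc

section Transcendence

variable {K F Γ₀ Γ₁ : Type*} [Field K] [Field F] [Algebra K F]
  [LinearOrderedCommGroupWithZero Γ₀] [LinearOrderedCommGroupWithZero Γ₁]

/-- The value group `w F` of a valued field, as a subgroup of the units of the codomain. -/
abbrev valueGroup (w : Valuation F Γ₁) : Subgroup Γ₁ˣ :=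
  MonoidWithZeroHom.valueGroup (MonoidWithZeroHom.ofClass w)

/-- The quotient `w F / w K` of the value group of `(F, w)` by the value group of the restriction
of `w` to `K`, written multiplicatively. -/
abbrev RelValueGroup (K : Type*) [Field K] [Algebra K F] (w : Valuation F Γ₁) : Type _ :=
  valueGroup w ⧸ (valueGroup (w.comap (algebraMap K F))).subgroupOf (valueGroup w)

/-- The rational rank of `w F / w K`, the dimension over `ℚ` of `(w F / w K) ⊗ ℚ`. -/
def rationalRank (K : Type*) [Field K] [Algebra K F] (w : Valuation F Γ₁) : Cardinal :=
  Module.rank ℚ (ℚ ⊗[ℤ] Additive (RelValueGroup K w))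

/-- The extension `(F | K, w)` is value transcendental: `w F / w K` has rational rank one. -/
def IsValueTranscendental (K : Type*) [Field K] [Algebra K F] (w : Valuation F Γ₁) : Prop :=
  rationalRank K w = 1

/-- The extension `w` of `v` is residue transcendental: the extension of residue fields has
transcendence degree one. -/
def IsResidueTranscendental (v : Valuation K Γ₀) (w : Valuation F Γ₁) [v.HasExtension w] : Prop :=
  Algebra.trdeg (IsLocalRing.ResidueField v.valuationSubring)
    (IsLocalRing.ResidueField w.valuationSubring) = 1

/-- The extension `w` of `v` is valuation transcendental. -/
def IsValuationTranscendental (v : Valuation K Γ₀) (w : Valuation F Γ₁) [v.HasExtension w] :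
    Prop :=
  IsValueTranscendental K w ∨ IsResidueTranscendental v w

end Transcendence

section CommonExtensions

variable {K L Γ₁ Γ₂ Γ : Type*} [Field K] [Field L] [Algebra K L]
  [LinearOrderedCommGroupWithZero Γ₁] [LinearOrderedCommGroupWithZero Γ₂]
  [LinearOrderedCommGroupWithZero Γ]

/-- The inclusion `K(x) → L(x)` induced by `K → L`, with `x ↦ x`. -/
def ratFuncMap (K L : Type*) [Field K] [Field L] [Algebra K L] : RatFunc K →+* RatFunc L :=
  RatFunc.mapRingHom (Polynomial.mapRingHom (algebraMap K L))
    (nonZeroDivisors_le_comap_nonZeroDivisors_of_injective _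
      (Polynomial.map_injective _ (algebraMap K L).injective))

/-- `W` is a common extension to `L(x)` of the valuation `w` on `K(x)` and the valuation `vbar`
on `L`. As usual, valuations are considered up to equivalence. -/
structure IsCommonExtension (w : Valuation (RatFunc K) Γ₁) (vbar : Valuation L Γ₂)
    (W : Valuation (RatFunc L) Γ) : Prop where
  ext_left : w.IsEquiv (W.comap (ratFuncMap K L))
  ext_right : vbar.IsEquiv (W.comap (algebraMap L (RatFunc L)))

/-- The set of common extensions of `w` and `vbar` to `L(x)`. An equivalence class of valuations
on `L(x)` is recorded by its valuation ring. -/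
def commonExtensions (w : Valuation (RatFunc K) Γ₁) (vbar : Valuation L Γ₂) :
    Set (ValuationSubring (RatFunc L)) :=
  {O | IsCommonExtension w vbar O.valuation}

/-- The value `u_{a,γ} f` for a valuation `u` on `L`, `a ∈ L`, and `γ` in the codomain of `u`.
If `f = ∑ cᵢ (x - a)ⁱ`, then additively `u_{a,γ} f = min (u cᵢ + i γ)`; in the multiplicative
notation used here this is the maximum of `u cᵢ * γ ^ i`. -/
def monomialValue (u : Valuation L Γ) (a : L) (γ : Γ) (f : L[X]) : Γ :=
  (taylor a f).support.sup fun i => u ((taylor a f).coeff i) * γ ^ i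

/-- `(a, γ)` is a pair of definition for `w`, relative to the common extension `W` of `w` and
`vbar`: the valuation `W` is `vbar_{a,γ}`. (Two valuations on `L(x)` which agree on `L[x]` are
equal; and `γ = W (x - a)`, so `γ` is an element of the value group of `W`.) -/
structure IsPairOfDefinition (w : Valuation (RatFunc K) Γ₁) (vbar : Valuation L Γ₂)
    (W : Valuation (RatFunc L) Γ) (a : L) (γ : Γ) : Prop where
  isCommonExtension : IsCommonExtension w vbar W
  eq_monomialValue : ∀ f : L[X], W (algebraMap L[X] (RatFunc L) f) =
    monomialValue (W.comap (algebraMap L (RatFunc L))) a γ f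

/-- `(a, γ)` is a minimal pair of definition for `w`: it is a pair of definition, and whenever
`b` in `L` satisfies (additively) `vbar (a - b) ≥ γ`, one has `[K(a) : K] ≤ [K(b) : K]`. The
values of `vbar` are compared with `γ` inside the value group of the common extension `W`. -/
structure IsMinimalPairOfDefinition (w : Valuation (RatFunc K) Γ₁) (vbar : Valuation L Γ₂)
    (W : Valuation (RatFunc L) Γ) (a : L) (γ : Γ) : Prop where
  isPairOfDefinition : IsPairOfDefinition w vbar W a γ
  minimal : ∀ b : L, W (algebraMap L (RatFunc L) (a - b)) ≤ γ →
    Module.finrank K (IntermediateField.adjoin K {a}) ≤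
      Module.finrank K (IntermediateField.adjoin K {b})

end CommonExtensions

end ValTransc

end

/-! Write `L` for the algebraic closure. Values are multiplicative, so an additively largest value
of `x - a` is here a smallest one.

Fix a common extension `W`. If no `W (x - a)` is smallest, every nonzero `y` in `L(x)` has a
constant `c` with `W (y - c) < W y` (`exists_val_sub_C_lt`). Then `L(x) | L` is immediate, so over
`K` the value group of `w` is torsion and its residue field algebraic, against valuation
transcendence. Hence some `a` gives the smallest value (`exists_minimal`); for a pair of definition
`(a, γ)` its first entry does.

By integrality `W (x - a) ^ N = W t` with `t` in `K(x)`. The elements `x - b`, for `b` conjugate to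
`a`, are the roots of a polynomial over `K(x)`. A lower bound on the values of all its roots can be
read off its coefficients, the outermost slope of the Newton polygon, so it depends only on `w`.
Transferring such bounds in both directions shows that any other common extension `W'` attains its
smallest value at a conjugate `a'` of `a`, with `W' (x - a') ^ N = W' t` (`exists_conjugate`).

Finally `a'` determines `W'` up to equivalence: `W' (x - b)` is the larger of `W' (x - a')` and `W'
(a' - b)`, and linear polynomials and constants generate `L(x)` (`IsCommonExtension.isEquiv`). So
common extensions inject into the roots of the minimal polynomial of `a`. -/

namespace ValTransc

/-! ### Values of roots and coefficients of a polynomial -/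

section Field

variable {F E Γ Γ' : Type*} [Field F] [Field E]
  [LinearOrderedCommGroupWithZero Γ] [LinearOrderedCommGroupWithZero Γ']

/-- In a vanishing sum, the value of a nonzero term is dominated by that of another term. -/
lemma exists_ne_val_le_of_sum_eq_zero {ι : Type*} (V : Valuation E Γ) (s : Finset ι) (z : ι → E)
    (hs : ∑ i ∈ s, z i = 0) {j : ι} (hj : j ∈ s) (hz : z j ≠ 0) :
    ∃ i ∈ s, i ≠ j ∧ V (z j) ≤ V (z i) := by
  classical
  by_contra! h
  have h1 : V (∑ i ∈ s.erase j, z i) < V (z j) :=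
    V.map_sum_lt ((V.ne_zero_iff).2 hz) fun i hi =>
      h i (Finset.mem_of_mem_erase hi) (Finset.ne_of_mem_erase hi)
  rw [← Finset.add_sum_erase s z hj] at hs
  rw [eq_neg_of_add_eq_zero_right hs, V.map_neg] at h1
  exact lt_irrefl _ h1

/-- The value of a nonzero algebraic element is torsion modulo the values of the base field. -/
lemma exists_val_pow_eq (φ : F →+* E) (V : Valuation E Γ) {y : E} (hy : y ≠ 0)
    (h : φ.IsIntegralElem y) :
    ∃ N : ℕ, 0 < N ∧ ∃ t : F, t ≠ 0 ∧ V y ^ N = V (φ t) := by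
  obtain ⟨p, hp, h0⟩ := h
  rw [eval₂_eq_sum, Polynomial.sum] at h0
  obtain ⟨j, hj, hmax⟩ := p.support.exists_max_image (fun i => V (φ (p.coeff i) * y ^ i))
    (support_nonempty.2 hp.ne_zero)
  have hne : ∀ i ∈ p.support, φ (p.coeff i) ≠ 0 := fun i hi => by
    simpa using hi
  -- The terms cancel, so the maximal value occurs twice; comparing the two terms gives a power of
  -- `V y` as a value from `F`.
  obtain ⟨i, hi, hij, hle⟩ := exists_ne_val_le_of_sum_eq_zero V p.support _ h0 hj
    (mul_ne_zero (hne j hj) (pow_ne_zero _ hy))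
  have heq := le_antisymm hle (hmax i hi)
  have key : ∀ {i j : ℕ}, i ∈ p.support → j ∈ p.support → i < j →
      V (φ (p.coeff i) * y ^ i) = V (φ (p.coeff j) * y ^ j) →
      ∃ N : ℕ, 0 < N ∧ ∃ t : F, t ≠ 0 ∧ V y ^ N = V (φ t) := by
    intro i j hi hj hij h
    refine ⟨j - i, by omega, p.coeff i / p.coeff j,
      div_ne_zero (mem_support_iff.1 hi) (mem_support_iff.1 hj), ?_⟩
    rw [map_div₀, ← map_pow]
    have hj' := (V.ne_zero_iff).2 (hne j hj)
    have hyi := (V.ne_zero_iff).2 (pow_ne_zero i hy)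
    rw [map_div₀, eq_div_iff hj']
    apply mul_right_cancel₀ hyi
    rw [← map_mul, ← map_mul, ← map_mul, h]
    congr 1
    rw [mul_right_comm, ← pow_add, Nat.sub_add_cancel hij.le, mul_comm]
  rcases lt_or_gt_of_ne hij with hlt | hlt
  · exact key hi hj hlt heq.symm
  · exact key hj hi hlt heq

/-- If all the roots `r` of `∏ (r - X)` satisfy `g ≤ V r ^ N`, then the coefficients of this
polynomial are bounded in terms of `g` and its constant coefficient. -/
lemma coeff_prod_sub_X_le (V : Valuation E Γ) (s : Multiset E) {N : ℕ} (hN : 0 < N) (g : Γ)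
    (hs : ∀ r ∈ s, g ≤ V r ^ N) (k : ℕ) :
    V ((s.map fun r => C r - X).prod.coeff k) ^ N * g ^ k ≤
      V ((s.map fun r => C r - X).prod.coeff 0) ^ N := by
  induction s using Multiset.induction_on generalizing k with
  | empty =>
    rcases k with _ | k
    · simp
    · simp [coeff_one, hN.ne']
  | cons r s ih =>
    have hs' : ∀ r ∈ s, g ≤ V r ^ N := fun r hr => hs r (Multiset.mem_cons_of_mem hr)
    set P := (s.map fun r => C r - X).prod with hP
    rcases k with _ | k
    · simp
    · rw [Multiset.map_cons, Multiset.prod_cons, ← hP, sub_mul, coeff_sub, coeff_C_mul, coeff_X_mul,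
        coeff_sub, coeff_C_mul, mul_coeff_zero X P, coeff_X_zero, zero_mul, sub_zero]
      have h1 := ih hs' k
      have h2 := ih hs' (k + 1)
      have h3 : V (r * P.coeff (k + 1) - P.coeff k) ^ N ≤
          max (V (r * P.coeff (k + 1)) ^ N) (V (P.coeff k) ^ N) := by
        rcases le_max_iff.1 (V.map_sub (r * P.coeff (k + 1)) (P.coeff k)) with h | h
        · exact le_max_of_le_left (pow_le_pow_left' h N)
        · exact le_max_of_le_right (pow_le_pow_left' h N)
      rw [map_mul V r (P.coeff 0), mul_pow]
      rcases le_max_iff.1 h3 with h | h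
      · calc _ ≤ V (r * P.coeff (k + 1)) ^ N * g ^ (k + 1) := by gcongr
          _ = V r ^ N * (V (P.coeff (k + 1)) ^ N * g ^ (k + 1)) := by
            rw [map_mul, mul_pow, mul_assoc]
          _ ≤ _ := by gcongr
      -- The index drops from `k + 1` to `k`; the spare factor `g` is absorbed by `g ≤ V r ^ N`.
      · calc _ ≤ V (P.coeff k) ^ N * g ^ (k + 1) := by gcongr
          _ = g * (V (P.coeff k) ^ N * g ^ k) := by rw [pow_succ]; ac_rfl
          _ ≤ V r ^ N * V (P.coeff 0) ^ N := mul_le_mul' (hs r (Multiset.mem_cons_self r s)) h1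

/-- If the coefficients of `P` are bounded in terms of `g` and its nonzero constant coefficient,
then the roots `r` of `P` satisfy `g ≤ V r ^ N`. -/
lemma le_val_root_pow (V : Valuation E Γ) (P : E[X]) (hP : P.coeff 0 ≠ 0) (N : ℕ) (g : Γ)
    (h : ∀ k, V (P.coeff k) ^ N * g ^ k ≤ V (P.coeff 0) ^ N) {r : E} (hr : P.eval r = 0) :
    g ≤ V r ^ N := by
  rw [eval_eq_sum, Polynomial.sum] at hr
  -- The constant term is dominated by a term of degree `k ≠ 0`; with `h k` this gives `g ^ k ≤ (V r
  -- ^ N) ^ k`.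
  obtain ⟨k, hk, hk0, hle⟩ := exists_ne_val_le_of_sum_eq_zero V P.support _ hr
    (mem_support_iff.2 hP) (by simpa using hP)
  have hPk : V (P.coeff k) ≠ 0 := (V.ne_zero_iff).2 (mem_support_iff.1 hk)
  have h1 : g ^ k ≤ (V r ^ N) ^ k := by
    have h2 : V (P.coeff k) ^ N * g ^ k ≤ V (P.coeff k) ^ N * (V r ^ N) ^ k := by
      refine (h k).trans ?_
      have := pow_le_pow_left' hle N
      simpa [mul_pow, ← pow_mul, mul_comm k N] using this
    exact le_of_mul_le_mul_left h2 (zero_lt_iff.2 (pow_ne_zero N hPk))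
  exact le_of_pow_le_pow_left₀ hk0 zero_le h1

/-- Two valuations with equivalent restrictions to the base field give the same lower bounds for
the values of the roots of a polynomial over the base field. -/
lemma le_val_root_pow_of_isEquiv (φ : F →+* E) {V : Valuation E Γ} {V' : Valuation E Γ'}
    (hV : (V.comap φ).IsEquiv (V'.comap φ)) (Q : F[X]) (s : Multiset E)
    (hQ : Q.map φ = (s.map fun r => C r - X).prod) (hs0 : ∀ r ∈ s, r ≠ 0) {N : ℕ}
    (hN : 0 < N) (t : F)
    (hs : ∀ r ∈ s, V (φ t) ≤ V r ^ N) : ∀ r ∈ s, V' (φ t) ≤ V' r ^ N := by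
  intro r hr
  have hc : ∀ k, φ (Q.coeff k) = (s.map fun r => C r - X).prod.coeff k := fun k => by
    rw [← hQ, coeff_map]
  refine le_val_root_pow V' (Q.map φ) ?_ N _ (fun k => ?_) (r := r) ?_
  · rw [hQ, coeff_zero_eq_eval_zero, eval_multiset_prod, Multiset.map_map]
    simp only [Function.comp_def, eval_sub, eval_C, eval_X, sub_zero, Multiset.map_id']
    exact Multiset.prod_ne_zero fun h => hs0 0 h rfl
  -- Both sides of the bound are values of elements of `F`, so it passes to `V'`.
  · have := coeff_prod_sub_X_le V s hN _ hs k
    rw [← hc, ← hc, ← map_pow, ← map_pow, ← map_pow, ← map_mul, ← map_pow, ← map_pow, ← map_pow,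
      ← map_mul] at this
    have := (hV _ _).1 this
    simpa [coeff_map] using this
  · rw [hQ, eval_multiset_prod, Multiset.map_map]
    exact Multiset.prod_eq_zero (Multiset.mem_map.2 ⟨r, hr, by simp⟩)

end Field

end ValTransc

namespace ValTransc

/-! ### The extension `L(x) | K(x)` -/

section RatFuncMap

variable {K L : Type*} [Field K] [Field L] [Algebra K L]

lemma ratFuncMap_algebraMap (p : K[X]) :
    ratFuncMap K L (algebraMap K[X] (RatFunc K) p) =
      algebraMap L[X] (RatFunc L) (p.map (algebraMap K L)) := by
  have h := RatFunc.map_apply_div (Polynomial.mapRingHom (algebraMap K L))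
    (nonZeroDivisors_le_comap_nonZeroDivisors_of_injective _
      (Polynomial.map_injective _ (algebraMap K L).injective)) p 1
  simp only [map_one, div_one, coe_mapRingHom] at h
  exact h

lemma ratFuncMap_C (c : K) :
    ratFuncMap K L (RatFunc.C c) = RatFunc.C (algebraMap K L c) := by
  have h := ratFuncMap_algebraMap (L := L) (C c)
  rwa [map_C, RatFunc.algebraMap_C, RatFunc.algebraMap_C] at h

lemma ratFuncMap_X : ratFuncMap K L RatFunc.X = RatFunc.X := by
  have h := ratFuncMap_algebraMap (K := K) (L := L) X
  rwa [map_X, RatFunc.algebraMap_X, RatFunc.algebraMap_X] at h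

lemma ratFuncMap_comp_C :
    (ratFuncMap K L).comp RatFunc.C = RatFunc.C.comp (algebraMap K L) :=
  RingHom.ext ratFuncMap_C

lemma X_sub_C_ne_zero (b : L) : (RatFunc.X - RatFunc.C b : RatFunc L) ≠ 0 := by
  rw [← RatFunc.algebraMap_X, ← RatFunc.algebraMap_C, ← map_sub]
  exact RatFunc.algebraMap_ne_zero (Polynomial.X_sub_C_ne_zero b)

lemma isIntegralElem_C [Algebra.IsAlgebraic K L] (b : L) :
    (ratFuncMap K L).IsIntegralElem (RatFunc.C b) := by
  obtain ⟨p, hp, h0⟩ := (Algebra.IsAlgebraic.isAlgebraic (R := K) b).isIntegral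
  refine ⟨p.map RatFunc.C, hp.map _, ?_⟩
  rw [eval₂_map, ratFuncMap_comp_C, ← hom_eval₂, h0, map_zero]

lemma isIntegralElem_X_sub_C [Algebra.IsAlgebraic K L] (b : L) :
    (ratFuncMap K L).IsIntegralElem (RatFunc.X - RatFunc.C b) := by
  refine RingHom.IsIntegralElem.sub _ ?_ (isIntegralElem_C b)
  rw [← ratFuncMap_X (K := K)]
  exact RingHom.isIntegralElem_map _

/-- The polynomial over `K(x)` with the roots `x - b`, for `b` a conjugate of `a`. -/
lemma exists_map_ratFuncMap_eq_prod [IsAlgClosed L] (f : K[X]) (hf : f.Monic) :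
    ∃ Q : (RatFunc K)[X], Q.map (ratFuncMap K L) =
      (((f.aroots L).map fun b => (RatFunc.X - RatFunc.C b : RatFunc L)).map
        fun r => C r - X).prod := by
  -- This is `f(x - T) = ∏ ((x - b) - T)`; the factors `C r - X` avoid a sign.
  refine ⟨(f.map RatFunc.C).comp (C RatFunc.X - X), ?_⟩
  rw [Polynomial.map_comp, map_map, ratFuncMap_comp_C, ← map_map]
  have h : f.map (algebraMap K L) = ((f.aroots L).map fun b => X - C b).prod := by
    have := (IsAlgClosed.splits (f.map (algebraMap K L))).eq_prod_roots
    rwa [(hf.map _).leadingCoeff, C_1, one_mul] at this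
  conv_lhs => rw [h]
  rw [Polynomial.map_multiset_prod, multiset_prod_comp, Multiset.map_map, Multiset.map_map,
    Multiset.map_map]
  congr 1
  refine Multiset.map_congr rfl fun b _ => ?_
  simp [ratFuncMap_X, sub_right_comm]

/-- A predicate on nonzero rational functions over an algebraically closed field holds as soon as
it holds for constants and linear polynomials and is stable under products and inverses. -/
lemma ratFunc_induction [IsAlgClosed L] (p : RatFunc L → Prop)
    (hC : ∀ c : L, c ≠ 0 → p (RatFunc.C c)) (hX : ∀ b : L, p (RatFunc.X - RatFunc.C b))
    (hmul : ∀ y z, y ≠ 0 → z ≠ 0 → p y → p z → p (y * z))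
    (hinv : ∀ y, y ≠ 0 → p y → p y⁻¹) (y : RatFunc L) (hy : y ≠ 0) : p y := by
  have hprod : ∀ s : Multiset L,
      (s.map fun b => (RatFunc.X - RatFunc.C b : RatFunc L)).prod ≠ 0 ∧
        p (s.map fun b => (RatFunc.X - RatFunc.C b : RatFunc L)).prod := by
    intro s
    induction s using Multiset.induction_on with
    | empty => simpa using hC 1 one_ne_zero
    | cons b s ih =>
      rw [Multiset.map_cons, Multiset.prod_cons]
      exact ⟨mul_ne_zero (X_sub_C_ne_zero b) ih.1,
        hmul _ _ (X_sub_C_ne_zero b) ih.1 (hX b) ih.2⟩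
  have hpoly : ∀ f : L[X], f ≠ 0 → p (algebraMap L[X] (RatFunc L) f) := by
    intro f hf
    have hlc := leadingCoeff_ne_zero.2 hf
    rw [(IsAlgClosed.splits f).eq_prod_roots, map_mul, RatFunc.algebraMap_C, map_multiset_prod,
      Multiset.map_map]
    simp only [Function.comp_def, map_sub, RatFunc.algebraMap_C, RatFunc.algebraMap_X]
    exact hmul _ _ (by simpa using hlc) (hprod _).1 (hC _ hlc) (hprod _).2
  have hn := RatFunc.num_ne_zero hy
  have hd := y.denom_ne_zero
  rw [← RatFunc.num_div_denom y, div_eq_mul_inv]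
  exact hmul _ _ (RatFunc.algebraMap_ne_zero hn) (inv_ne_zero (RatFunc.algebraMap_ne_zero hd))
    (hpoly _ hn) (hinv _ (RatFunc.algebraMap_ne_zero hd) (hpoly _ hd))

end RatFuncMap

/-! ### Counting common extensions by conjugates -/

section Count

variable {K L Γ₁ Γ₂ Γ Γ' : Type*} [Field K] [Field L] [Algebra K L]
  [LinearOrderedCommGroupWithZero Γ₁] [LinearOrderedCommGroupWithZero Γ₂]
  [LinearOrderedCommGroupWithZero Γ] [LinearOrderedCommGroupWithZero Γ']
  {w : Valuation (RatFunc K) Γ₁} {vbar : Valuation L Γ₂}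
  {W : Valuation (RatFunc L) Γ} {W' : Valuation (RatFunc L) Γ'}

lemma IsCommonExtension.comap_ratFuncMap_isEquiv (h : IsCommonExtension w vbar W)
    (h' : IsCommonExtension w vbar W') :
    (W.comap (ratFuncMap K L)).IsEquiv (W'.comap (ratFuncMap K L)) :=
  h.ext_left.symm.trans h'.ext_left

lemma IsCommonExtension.comap_C_isEquiv (h : IsCommonExtension w vbar W)
    (h' : IsCommonExtension w vbar W') :
    (W.comap RatFunc.C).IsEquiv (W'.comap RatFunc.C) := by
  have := h.ext_right.symm.trans h'.ext_right
  rwa [RatFunc.algebraMap_eq_C] at this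

/-- A lower bound, given by an element of `K(x)`, for powers of the values of all the `x - b` with
`b` conjugate to `a` carries over from one common extension to every other one. -/
lemma IsCommonExtension.le_val_X_sub_C_pow [IsAlgClosed L] [Algebra.IsAlgebraic K L]
    (h : IsCommonExtension w vbar W) (h' : IsCommonExtension w vbar W') {a : L} {N : ℕ}
    (hN : 0 < N) (t : RatFunc K)
    (ht : ∀ b ∈ (minpoly K a).aroots L, W (ratFuncMap K L t) ≤ W (RatFunc.X - RatFunc.C b) ^ N) :
    ∀ b ∈ (minpoly K a).aroots L, W' (ratFuncMap K L t) ≤ W' (RatFunc.X - RatFunc.C b) ^ N := by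
  have ha : IsIntegral K a := (Algebra.IsAlgebraic.isAlgebraic a).isIntegral
  obtain ⟨Q, hQ⟩ := exists_map_ratFuncMap_eq_prod (L := L) _ (minpoly.monic ha)
  have := le_val_root_pow_of_isEquiv (ratFuncMap K L) (h.comap_ratFuncMap_isEquiv h') Q _ hQ
    (by simpa only [Multiset.mem_map, forall_exists_index, and_imp, forall_apply_eq_imp_iff₂]
      using fun b _ => X_sub_C_ne_zero b) hN t
    (by simpa only [Multiset.mem_map, forall_exists_index, and_imp, forall_apply_eq_imp_iff₂]
      using ht)
  intro b hb
  exact this _ (Multiset.mem_map_of_mem _ hb)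

lemma self_mem_aroots_minpoly [Algebra.IsAlgebraic K L] (a : L) :
    a ∈ (minpoly K a).aroots L := by
  have ha : IsIntegral K a := (Algebra.IsAlgebraic.isAlgebraic a).isIntegral
  exact (mem_aroots).2 ⟨minpoly.ne_zero ha, minpoly.aeval K a⟩

/-- If `W (x - a)` is minimal, then for every other common extension `W'` there is a conjugate
`a'` of `a` for which `W' (x - a')` is minimal, and its value is determined by `W (x - a)`. -/
lemma IsCommonExtension.exists_conjugate [IsAlgClosed L] [Algebra.IsAlgebraic K L]
    (h : IsCommonExtension w vbar W) (h' : IsCommonExtension w vbar W') {a : L}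
    (ha : ∀ b, W (RatFunc.X - RatFunc.C a) ≤ W (RatFunc.X - RatFunc.C b)) {N : ℕ} (hN : 0 < N)
    (t : RatFunc K) (ht : W (RatFunc.X - RatFunc.C a) ^ N = W (ratFuncMap K L t)) :
    ∃ a' ∈ (minpoly K a).aroots L,
      (∀ b, W' (RatFunc.X - RatFunc.C a') ≤ W' (RatFunc.X - RatFunc.C b)) ∧
        W' (RatFunc.X - RatFunc.C a') ^ N = W' (ratFuncMap K L t) := by
  classical
  -- The bound holds for `W` at every element of `L`, so it transfers through the minimal polynomial
  -- of each `b`.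
  have hlow : ∀ b, W' (ratFuncMap K L t) ≤ W' (RatFunc.X - RatFunc.C b) ^ N := fun b =>
    h.le_val_X_sub_C_pow h' hN t (fun c _ => ht ▸ pow_le_pow_left' (ha c) N) b
      (self_mem_aroots_minpoly b)
  obtain ⟨a', ha', hmin⟩ := ((minpoly K a).aroots L).toFinset.exists_min_image
    (fun b => W' (RatFunc.X - RatFunc.C b)) ⟨a, Multiset.mem_toFinset.2 (self_mem_aroots_minpoly a)⟩
  -- For the reverse inequality, the bound that `s` gives on the conjugates is carried back from
  -- `W'` to `W`, where it compares `s ^ N` with `t ^ M` in `K(x)`.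
  obtain ⟨M, hM, s, -, hs⟩ := exists_val_pow_eq (ratFuncMap K L) W' (X_sub_C_ne_zero a')
    (isIntegralElem_X_sub_C a')
  have h1 : W (ratFuncMap K L s) ≤ W (RatFunc.X - RatFunc.C a) ^ M :=
    h'.le_val_X_sub_C_pow h hM s (fun c hc => hs ▸ pow_le_pow_left'
      (hmin c (Multiset.mem_toFinset.2 hc)) M) a (self_mem_aroots_minpoly a)
  have h2 : W (ratFuncMap K L (s ^ N)) ≤ W (ratFuncMap K L (t ^ M)) := by
    rw [map_pow, map_pow, map_pow, map_pow, ← ht, ← pow_mul, mul_comm N M, pow_mul]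
    exact pow_le_pow_left' h1 N
  have h3 : W' (ratFuncMap K L (s ^ N)) ≤ W' (ratFuncMap K L (t ^ M)) :=
    (h.comap_ratFuncMap_isEquiv h' _ _).1 h2
  rw [map_pow, map_pow, map_pow, map_pow, ← hs, ← pow_mul, mul_comm M N, pow_mul] at h3
  have heq : W' (RatFunc.X - RatFunc.C a') ^ N = W' (ratFuncMap K L t) :=
    le_antisymm (le_of_pow_le_pow_left₀ hM.ne' zero_le h3) (hlow a')
  exact ⟨a', Multiset.mem_toFinset.1 ha',
    fun b => le_of_pow_le_pow_left₀ hN.ne' zero_le (heq ▸ hlow b), heq⟩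

/-- If `W (x - a)` is minimal, it determines the values of all the polynomials `x - b`. -/
lemma val_X_sub_C_eq_max {a : L}
    (ha : ∀ b, W (RatFunc.X - RatFunc.C a) ≤ W (RatFunc.X - RatFunc.C b)) (b : L) :
    W (RatFunc.X - RatFunc.C b) = max (W (RatFunc.X - RatFunc.C a)) (W (RatFunc.C (a - b))) := by
  apply le_antisymm
  · have : (RatFunc.X - RatFunc.C b : RatFunc L) =
      (RatFunc.X - RatFunc.C a) + RatFunc.C (a - b) := by rw [map_sub]; ring
    rw [this]
    exact W.map_add _ _
  · refine max_le (ha b) ?_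
    have : (RatFunc.C (a - b) : RatFunc L) =
      (RatFunc.X - RatFunc.C b) - (RatFunc.X - RatFunc.C a) := by rw [map_sub]; ring
    rw [this]
    exact (W.map_sub _ _).trans (max_le le_rfl (ha b))

/-- Some power of `y` has the same value as an element of `K(x)`, simultaneously for `W`, `W'`. -/
def CommonlyTorsion (K : Type*) [Field K] [Algebra K L] (W : Valuation (RatFunc L) Γ)
    (W' : Valuation (RatFunc L) Γ') (y : RatFunc L) : Prop :=
  ∃ M : ℕ, 0 < M ∧ ∃ t : RatFunc K, W y ^ M = W (ratFuncMap K L t) ∧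
    W' y ^ M = W' (ratFuncMap K L t)

lemma CommonlyTorsion.mul {y z : RatFunc L} (hy : CommonlyTorsion K W W' y)
    (hz : CommonlyTorsion K W W' z) : CommonlyTorsion K W W' (y * z) := by
  obtain ⟨M, hM, t, h1, h2⟩ := hy
  obtain ⟨N, hN, s, h3, h4⟩ := hz
  refine ⟨M * N, Nat.mul_pos hM hN, t ^ N * s ^ M, ?_, ?_⟩
  · simp only [map_mul, map_pow, mul_pow, ← h1, ← h3, ← pow_mul, mul_comm N M]
  · simp only [map_mul, map_pow, mul_pow, ← h2, ← h4, ← pow_mul, mul_comm N M]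

lemma CommonlyTorsion.inv {y : RatFunc L} (hy : CommonlyTorsion K W W' y) :
    CommonlyTorsion K W W' y⁻¹ := by
  obtain ⟨M, hM, t, h1, h2⟩ := hy
  exact ⟨M, hM, t⁻¹, by simp [← h1], by simp [← h2]⟩

/-- One exponent and one element of `K` serve both valuations, since their restrictions to `L` are
equivalent. -/
lemma IsCommonExtension.commonlyTorsion_C [Algebra.IsAlgebraic K L]
    (h : IsCommonExtension w vbar W) (h' : IsCommonExtension w vbar W') {c : L} (hc : c ≠ 0) :
    CommonlyTorsion K W W' (RatFunc.C c) := by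
  obtain ⟨M, hM, k, -, hk⟩ := exists_val_pow_eq (algebraMap K L) (W.comap RatFunc.C) hc
    (Algebra.IsAlgebraic.isAlgebraic (R := K) c).isIntegral
  refine ⟨M, hM, RatFunc.C k, ?_, ?_⟩
  · simpa [ratFuncMap_C] using hk
  · rw [← map_pow, (h.comap_C_isEquiv h').eq_iff, map_pow] at hk
    simpa [ratFuncMap_C] using hk

/-- If two common extensions have the same `a` for which the value of `x - a` is minimal, and this
value is torsion over the same element of `K(x)`, then they are equivalent. -/
lemma IsCommonExtension.isEquiv [IsAlgClosed L] [Algebra.IsAlgebraic K L]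
    (h : IsCommonExtension w vbar W) (h' : IsCommonExtension w vbar W') {a : L}
    (ha : ∀ b, W (RatFunc.X - RatFunc.C a) ≤ W (RatFunc.X - RatFunc.C b))
    (ha' : ∀ b, W' (RatFunc.X - RatFunc.C a) ≤ W' (RatFunc.X - RatFunc.C b))
    (hta : CommonlyTorsion K W W' (RatFunc.X - RatFunc.C a)) : W.IsEquiv W' := by
  have hE := h.comap_ratFuncMap_isEquiv h'
  have hX : ∀ b, CommonlyTorsion K W W' (RatFunc.X - RatFunc.C b) := by
    intro b
    rcases eq_or_ne a b with rfl | hab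
    · exact hta
    obtain ⟨M, hM, t, h1, h2⟩ := hta
    obtain ⟨N, hN, s, h3, h4⟩ := h.commonlyTorsion_C h' (sub_ne_zero.2 hab)
    -- Raised to the power `M * N`, either comparison becomes one between `t ^ N` and `s ^ M` in
    -- `K(x)`, where the valuations agree.
    have hiff : W (RatFunc.X - RatFunc.C a) ≤ W (RatFunc.C (a - b)) ↔
        W' (RatFunc.X - RatFunc.C a) ≤ W' (RatFunc.C (a - b)) := by
      rw [← pow_le_pow_iff_left₀ zero_le zero_le (Nat.mul_pos hM hN).ne',
        ← pow_le_pow_iff_left₀ (a := W' _) zero_le zero_le (Nat.mul_pos hM hN).ne',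
        pow_mul (W _), pow_mul' (W _), pow_mul (W' _), pow_mul' (W' _), h1, h2, h3, h4]
      simpa using hE (t ^ N) (s ^ M)
    by_cases hle : W (RatFunc.X - RatFunc.C a) ≤ W (RatFunc.C (a - b))
    · refine ⟨N, hN, s, ?_, ?_⟩
      · rw [val_X_sub_C_eq_max ha, max_eq_right hle, h3]
      · rw [val_X_sub_C_eq_max ha', max_eq_right (hiff.1 hle), h4]
    · refine ⟨M, hM, t, ?_, ?_⟩
      · rw [val_X_sub_C_eq_max ha, max_eq_left (le_of_not_ge hle), h1]
      · rw [val_X_sub_C_eq_max ha', max_eq_left (le_of_not_ge fun hc => hle (hiff.2 hc)), h2]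
  rw [Valuation.isEquiv_iff_val_le_one]
  intro y
  rcases eq_or_ne y 0 with rfl | hy
  · simp
  obtain ⟨M, hM, t, h1, h2⟩ := ratFunc_induction (CommonlyTorsion K W W')
    (fun c hc => h.commonlyTorsion_C h' hc) hX (fun _ _ _ _ => .mul) (fun _ _ => .inv) y hy
  rw [← pow_le_one_iff_of_nonneg zero_le hM.ne', h1,
    ← pow_le_one_iff_of_nonneg (a := W' y) zero_le hM.ne', h2]
  exact hE.le_one_iff_le_one

/-- If `W (x - a)` is minimal for some common extension, then there are at most `[K(a) : K]` common
extensions. -/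
theorem IsCommonExtension.finite_and_ncard_le [IsAlgClosed L] [Algebra.IsAlgebraic K L]
    (h : IsCommonExtension w vbar W) {a : L}
    (ha : ∀ b, W (RatFunc.X - RatFunc.C a) ≤ W (RatFunc.X - RatFunc.C b)) :
    (commonExtensions w vbar).Finite ∧ (commonExtensions w vbar).ncard ≤
      Module.finrank K (IntermediateField.adjoin K {a}) := by
  classical
  obtain ⟨N, hN, t, -, ht⟩ := exists_val_pow_eq (ratFuncMap K L) W (X_sub_C_ne_zero a)
    (isIntegralElem_X_sub_C a)
  have hex : ∀ O : ValuationSubring (RatFunc L), ∃ a' : L, O ∈ commonExtensions w vbar →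
      a' ∈ (minpoly K a).aroots L ∧
      (∀ b, O.valuation (RatFunc.X - RatFunc.C a') ≤ O.valuation (RatFunc.X - RatFunc.C b)) ∧
        O.valuation (RatFunc.X - RatFunc.C a') ^ N = O.valuation (ratFuncMap K L t) := by
    intro O
    by_cases hO : O ∈ commonExtensions w vbar
    · obtain ⟨a', h1, h2⟩ := h.exists_conjugate hO ha hN t ht
      exact ⟨a', fun _ => ⟨h1, h2⟩⟩
    -- An arbitrary value: `conj` is used only on common extensions.
    · exact ⟨0, fun hO' => absurd hO' hO⟩
  choose conj hconj using hex
  have hmaps : ∀ O ∈ commonExtensions w vbar,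
      conj O ∈ (((minpoly K a).aroots L).toFinset : Set L) := fun O hO => by
    simpa only [Finset.mem_coe, Multiset.mem_toFinset] using (hconj O hO).1
  have hinj : Set.InjOn conj (commonExtensions w vbar) := by
    intro O hO O' hO' heq
    obtain ⟨-, h1, h2⟩ := hconj O hO
    obtain ⟨-, h3, h4⟩ := hconj O' hO'
    rw [← heq] at h3 h4
    have := IsCommonExtension.isEquiv hO hO' h1 h3 ⟨N, hN, t, h2, h4⟩
    ext y
    rw [← O.valuation_le_one_iff, ← O'.valuation_le_one_iff]
    exact this.le_one_iff_le_one
  have hint : IsIntegral K a := (Algebra.IsAlgebraic.isAlgebraic a).isIntegral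
  refine ⟨Set.Finite.of_injOn hmaps hinj (Finset.finite_toSet _), ?_⟩
  calc (commonExtensions w vbar).ncard
      ≤ (((minpoly K a).aroots L).toFinset : Set L).ncard :=
        Set.ncard_le_ncard_of_injOn conj hmaps hinj (Finset.finite_toSet _)
    _ = ((minpoly K a).aroots L).toFinset.card := Set.ncard_coe_finset _
    _ ≤ ((minpoly K a).aroots L).card := Multiset.toFinset_card_le _
    _ ≤ ((minpoly K a).map (algebraMap K L)).natDegree := card_roots' _
    _ = Module.finrank K (IntermediateField.adjoin K {a}) := by
      rw [natDegree_map, IntermediateField.adjoin.finrank hint]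

end Count

end ValTransc

namespace ValTransc

/-! ### Existence of a minimal value -/

section Immediate

variable {K L Γ₀ Γ₁ Γ₂ Γ : Type*} [Field K] [Field L] [Algebra K L]
  [LinearOrderedCommGroupWithZero Γ₀] [LinearOrderedCommGroupWithZero Γ₁]
  [LinearOrderedCommGroupWithZero Γ₂] [LinearOrderedCommGroupWithZero Γ]
  {v : Valuation K Γ₀} {w : Valuation (RatFunc K) Γ₁} {vbar : Valuation L Γ₂}
  {W : Valuation (RatFunc L) Γ}

/-- If no value `W (x - a)` is minimal, then `(L(x) | L, W)` is an immediate extension. -/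
lemma exists_val_sub_C_lt [IsAlgClosed L]
    (hW : ∀ a, ∃ b, W (RatFunc.X - RatFunc.C b) < W (RatFunc.X - RatFunc.C a))
    (y : RatFunc L) (hy : y ≠ 0) : ∃ c : L, W (y - RatFunc.C c) < W y := by
  have hval : ∀ {y : RatFunc L} {c : L}, W (y - RatFunc.C c) < W y → W (RatFunc.C c) = W y :=
    fun {y c} h => by
      rw [Valuation.map_sub_swap] at h
      exact W.map_eq_of_sub_lt h
  refine ratFunc_induction (fun y => ∃ c : L, W (y - RatFunc.C c) < W y) ?_ ?_ ?_ ?_ y hy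
  · intro c hc
    exact ⟨c, by simpa [zero_lt_iff] using hc⟩
  · intro a
    obtain ⟨b, hb⟩ := hW a
    exact ⟨b - a, by
      rwa [map_sub RatFunc.C, sub_sub_sub_cancel_right]⟩
  · rintro y z hy hz ⟨c, hc⟩ ⟨d, hd⟩
    refine ⟨c * d, ?_⟩
    have h0y : 0 < W y := zero_lt_iff.2 ((W.ne_zero_iff).2 hy)
    have h0z : 0 < W z := zero_lt_iff.2 ((W.ne_zero_iff).2 hz)
    -- Both summands have value below `W y * W z`, because `W d = W z`.
    have : y * z - RatFunc.C (c * d) = y * (z - RatFunc.C d) + RatFunc.C d * (y - RatFunc.C c) := by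
      rw [map_mul]; ring
    rw [this, map_mul W y z]
    refine W.map_add_lt ?_ ?_
    · rw [map_mul]
      exact mul_lt_mul_of_pos_left hd h0y
    · rw [map_mul, hval hd, mul_comm]
      exact mul_lt_mul_of_pos_right hc h0z
  · rintro y hy ⟨c, hc⟩
    refine ⟨c⁻¹, ?_⟩
    have h0y : W y ≠ 0 := (W.ne_zero_iff).2 hy
    have hc0 : RatFunc.C c ≠ (0 : RatFunc L) := (W.ne_zero_iff).1 (by rwa [hval hc])
    have : y⁻¹ - RatFunc.C c⁻¹ = -((y - RatFunc.C c) * (y⁻¹ * (RatFunc.C c)⁻¹)) := by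
      rw [map_inv₀]; field_simp; ring
    rw [this, W.map_neg, map_mul, map_mul, map_inv₀, map_inv₀, hval hc]
    calc W (y - RatFunc.C c) * ((W y)⁻¹ * (W y)⁻¹)
        < W y * ((W y)⁻¹ * (W y)⁻¹) := mul_lt_mul_of_pos_right hc (by
          rw [zero_lt_iff]; exact mul_ne_zero (inv_ne_zero h0y) (inv_ne_zero h0y))
      _ = (W y)⁻¹ := by rw [← mul_assoc, mul_inv_cancel₀ h0y, one_mul]

/-- The rational rank vanishes if every value is torsion modulo the values of the base field. -/
lemma rationalRank_eq_zero {F : Type*} [Field F] [Algebra K F] (w : Valuation F Γ₁)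
    (h : ∀ y : F, y ≠ 0 → ∃ N : ℕ, 0 < N ∧ ∃ t : K, w y ^ N = w (algebraMap K F t)) :
    rationalRank K w = 0 := by
  have htors : ∀ g : RelValueGroup K w, ∃ N : ℕ, 0 < N ∧ g ^ N = 1 := by
    intro g
    obtain ⟨⟨g, hg⟩, rfl⟩ := QuotientGroup.mk_surjective g
    obtain ⟨a, ha, y, hy⟩ := (MonoidWithZeroHom.mem_valueGroup_iff_of_comm _).1 hg
    have ha' : w a ≠ 0 := ha
    have hy' : w a * g = w y := hy
    have ha0 : a ≠ 0 := (w.ne_zero_iff).1 ha'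
    have hy0 : y ≠ 0 := by
      rintro rfl
      rw [map_zero] at hy'
      exact mul_ne_zero ha' g.ne_zero hy'
    obtain ⟨N, hN, t, ht⟩ := h (y / a) (div_ne_zero hy0 ha0)
    refine ⟨N, hN, ?_⟩
    rw [← QuotientGroup.mk_pow, QuotientGroup.eq_one_iff, Subgroup.mem_subgroupOf]
    refine MonoidWithZeroHom.mem_valueGroup _ ⟨t, ?_⟩
    change w (algebraMap K F t) = _
    rw [← ht, map_div₀, ← hy', mul_div_cancel_left₀ _ ha']
    simp
  have hsub : Subsingleton (ℚ ⊗[ℤ] Additive (RelValueGroup K w)) := by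
    refine subsingleton_of_forall_eq 0 fun z => ?_
    induction z using TensorProduct.induction_on with
    | zero => rfl
    | add x y hx hy => rw [hx, hy, add_zero]
    | tmul q g =>
      obtain ⟨N, hN, hg⟩ := htors g.toMul
      have hg' : (N : ℤ) • g = 0 := by
        rw [natCast_zsmul]; exact hg
      -- Moving `N` across the tensor sign kills `g`.
      have hq : q = (N : ℤ) • (q / N) := by
        rw [zsmul_eq_mul, Int.cast_natCast, mul_div_cancel₀]
        exact_mod_cast hN.ne'
      rw [hq, TensorProduct.smul_tmul, hg', TensorProduct.tmul_zero]
  rw [rationalRank]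
  exact rank_subsingleton' ℚ _

/-- The residue field extension is algebraic if every integer satisfies, modulo the maximal ideal,
a polynomial equation with coefficients in the base field, one of which is a unit. -/
lemma residueField_isAlgebraic {F : Type*} [Field F] [Algebra K F] (v : Valuation K Γ₀)
    (w : Valuation F Γ₁) [v.HasExtension w]
    (h : ∀ y : F, w y ≤ 1 → ∃ q : K[X], (∀ i, v (q.coeff i) ≤ 1) ∧ (∃ i, v (q.coeff i) = 1) ∧
      w (aeval y q) < 1) :
    Algebra.IsAlgebraic (IsLocalRing.ResidueField v.valuationSubring)
      (IsLocalRing.ResidueField w.valuationSubring) := by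
  refine ⟨fun z => ?_⟩
  obtain ⟨y, rfl⟩ := IsLocalRing.residue_surjective z
  obtain ⟨q, hq, ⟨j, hj⟩, hlt⟩ := h y y.2
  have hlift : q ∈ lifts (algebraMap v.valuationSubring K) := by
    rw [lifts_iff_coeff_lifts]
    exact fun i => ⟨⟨q.coeff i, hq i⟩, rfl⟩
  obtain ⟨p, rfl⟩ := (mem_lifts _).1 hlift
  refine ⟨p.map (IsLocalRing.residue _), ?_, ?_⟩
  · intro h0
    have h1 : IsLocalRing.residue _ (p.coeff j) = 0 := by rw [← coeff_map, h0, coeff_zero]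
    rw [IsLocalRing.residue_eq_zero_iff, IsLocalRing.mem_maximalIdeal, mem_nonunits_iff] at h1
    apply h1
    refine (Valuation.integer.integers v).isUnit_iff_valuation_eq_one.2 ?_
    rw [coeff_map] at hj
    exact hj
  · have h1 : aeval (IsLocalRing.residue _ y) (p.map (IsLocalRing.residue v.valuationSubring)) =
        IsLocalRing.residue w.valuationSubring (aeval y p) := by
      rw [aeval_def, eval₂_map, aeval_def, hom_eval₂]
      rfl
    rw [h1, IsLocalRing.residue_eq_zero_iff, IsLocalRing.mem_maximalIdeal, mem_nonunits_iff]
    have h2 : ((aeval y p : w.valuationSubring) : F) =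
        aeval (y : F) (p.map (algebraMap v.valuationSubring K)) := by
      rw [aeval_map_algebraMap]
      exact (aeval_algebraMap_apply F y p).symm
    intro hu
    have h3 := (Valuation.integer.integers w).isUnit_iff_valuation_eq_one.1 hu
    change w ((aeval y p : w.valuationSubring) : F) = 1 at h3
    rw [h2] at h3
    exact hlt.ne h3

/-- A polynomial with integral coefficients takes congruent values at congruent arguments. -/
lemma val_eval₂_sub_eval₂_lt_one {E : Type*} [Field E] (φ : K →+* E) (V : Valuation E Γ)
    (q : K[X]) (hq : ∀ i, V (φ (q.coeff i)) ≤ 1) {y z : E} (hy : V y ≤ 1) (hz : V z ≤ 1)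
    (hyz : V (y - z) < 1) :
    V (eval₂ φ y q - eval₂ φ z q) < 1 := by
  have hpow : ∀ i : ℕ, V (y ^ i - z ^ i) < 1 := by
    intro i
    induction i with
    | zero => simp
    | succ i ih =>
      have : y ^ (i + 1) - z ^ (i + 1) = y * (y ^ i - z ^ i) + z ^ i * (y - z) := by ring
      rw [this]
      refine V.map_add_lt ?_ ?_
      · rw [map_mul]
        exact (mul_le_of_le_one_left' hy).trans_lt ih
      · rw [map_mul, map_pow]
        exact (mul_le_of_le_one_left' (pow_le_one' hz i)).trans_lt hyz
  rw [eval₂_eq_sum_range, eval₂_eq_sum_range, ← Finset.sum_sub_distrib]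
  refine V.map_sum_lt one_ne_zero fun i _ => ?_
  rw [← mul_sub, map_mul]
  exact (mul_le_of_le_one_left' (hq i)).trans_lt (hpow i)

/-- An algebraic element is a root of a polynomial with integral coefficients, one of which is a
unit. -/
lemma exists_aeval_eq_zero_of_isAlgebraic (v : Valuation K Γ₀) {c : L} (hc : IsAlgebraic K c) :
    ∃ q : K[X], (∀ i, v (q.coeff i) ≤ 1) ∧ (∃ i, v (q.coeff i) = 1) ∧ aeval c q = 0 := by
  obtain ⟨p, hp, h0⟩ := hc
  obtain ⟨j, hj, hmax⟩ := p.support.exists_max_image (fun i => v (p.coeff i))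
    (support_nonempty.2 hp)
  have hj0 : v (p.coeff j) ≠ 0 := (v.ne_zero_iff).2 (mem_support_iff.1 hj)
  -- Dividing by a coefficient of largest value makes all coefficients integral and that one `1`.
  refine ⟨C (p.coeff j)⁻¹ * p, fun i => ?_, ⟨j, ?_⟩, ?_⟩
  · rw [coeff_C_mul, map_mul, map_inv₀, inv_mul_le_one₀ (zero_lt_iff.2 hj0)]
    by_cases hi : i ∈ p.support
    · exact hmax i hi
    · rw [notMem_support_iff.1 hi, map_zero]
      exact zero_le
  · rw [coeff_C_mul, map_mul, map_inv₀, inv_mul_cancel₀ hj0]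
  · rw [map_mul, h0, mul_zero]

/-- For a common extension of a valuation transcendental extension, some value `W (x - a)` is
minimal. -/
lemma IsCommonExtension.exists_minimal [IsAlgClosed L] [Algebra.IsAlgebraic K L]
    [v.HasExtension w] (hw : IsValuationTranscendental v w) (h : IsCommonExtension w vbar W) :
    ∃ a, ∀ b, W (RatFunc.X - RatFunc.C a) ≤ W (RatFunc.X - RatFunc.C b) := by
  by_contra! hW
  have himm := exists_val_sub_C_lt hW
  have hC : ∀ k : K, ratFuncMap K L (algebraMap K (RatFunc K) k) =
      RatFunc.C (algebraMap K L k) := fun k => by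
    rw [RatFunc.algebraMap_eq_C, ratFuncMap_C]
  rcases hw with hw | hw
  · have h0 : rationalRank K w = 0 := by
      refine rationalRank_eq_zero w fun y hy => ?_
      have hy' : ratFuncMap K L y ≠ 0 := (_root_.map_ne_zero _).2 hy
      obtain ⟨c, hc⟩ := himm _ hy'
      rw [Valuation.map_sub_swap] at hc
      have hcy := W.map_eq_of_sub_lt hc
      have hc0 : c ≠ 0 := by
        rintro rfl
        rw [map_zero, map_zero] at hcy
        exact (W.ne_zero_iff).2 hy' hcy.symm
      obtain ⟨N, hN, k, -, hk⟩ := exists_val_pow_eq (algebraMap K L) (W.comap RatFunc.C) hc0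
        (Algebra.IsAlgebraic.isAlgebraic (R := K) c).isIntegral
      refine ⟨N, hN, k, ?_⟩
      rw [← map_pow, h.ext_left.eq_iff]
      simp only [Valuation.comap_apply, map_pow, hC] at hk ⊢
      rw [← hcy, hk]
    exact zero_ne_one (h0.symm.trans hw)
  · have : Algebra.IsAlgebraic (IsLocalRing.ResidueField v.valuationSubring)
      (IsLocalRing.ResidueField w.valuationSubring) := by
      refine residueField_isAlgebraic v w fun y hy => ?_
      have hvW : v.IsEquiv (W.comap (RatFunc.C.comp (algebraMap K L))) := by
        refine (Valuation.HasExtension.val_isEquiv_comap (vR := v) (vA := w)).trans ?_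
        have := h.ext_left.comap (algebraMap K (RatFunc K))
        rwa [← Valuation.comap_comp, RatFunc.algebraMap_eq_C, ratFuncMap_comp_C] at this
      -- The constant `c` has the same residue as `y` and is algebraic over `K`, so a normalized
      -- equation `q` of `c` satisfies `q(y) ≡ q(c) = 0`.
      obtain ⟨c, hc⟩ : ∃ c : L, W (ratFuncMap K L y - RatFunc.C c) < 1 := by
        rcases eq_or_ne y 0 with rfl | hy0
        · exact ⟨0, by simp⟩
        · obtain ⟨c, hc⟩ := himm _ ((_root_.map_ne_zero (ratFuncMap K L)).2 hy0)
          exact ⟨c, hc.trans_le (h.ext_left.le_one_iff_le_one.1 hy)⟩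
      have hWy : W (ratFuncMap K L y) ≤ 1 := h.ext_left.le_one_iff_le_one.1 hy
      have hWc : W (RatFunc.C c) ≤ 1 := by
        have := (W.map_sub (ratFuncMap K L y) (ratFuncMap K L y - RatFunc.C c)).trans
          (max_le hWy hc.le)
        rwa [sub_sub_cancel] at this
      obtain ⟨q, hq, hq1, hq0⟩ := exists_aeval_eq_zero_of_isAlgebraic v
        (Algebra.IsAlgebraic.isAlgebraic (R := K) c)
      refine ⟨q, hq, hq1, ?_⟩
      rw [h.ext_left.lt_one_iff_lt_one]
      have hy' : ratFuncMap K L (aeval y q) =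
          eval₂ (RatFunc.C.comp (algebraMap K L)) (ratFuncMap K L y) q := by
        rw [aeval_def, hom_eval₂, RatFunc.algebraMap_eq_C, ratFuncMap_comp_C]
      have hc' : eval₂ (RatFunc.C.comp (algebraMap K L)) (RatFunc.C c) q = 0 := by
        rw [← hom_eval₂, ← aeval_def, hq0, map_zero]
      have hlt := val_eval₂_sub_eval₂_lt_one _ W q
        (fun i => hvW.le_one_iff_le_one.1 (hq i)) hWy hWc hc
      rwa [hc', sub_zero, ← hy'] at hlt
    have h0 := trdeg_eq_zero (R := IsLocalRing.ResidueField v.valuationSubring)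
      (A := IsLocalRing.ResidueField w.valuationSubring)
    exact zero_ne_one (h0.symm.trans hw)

/-! ### Pairs of definition -/

lemma monomialValue_X_sub_C (u : Valuation L Γ) (a b : L) (γ : Γ) :
    monomialValue u a γ (X - C b) = max γ (u (a - b)) := by
  have ht : taylor a (X - C b) = X + C (a - b) := by simp [add_sub_assoc]
  have hd : (X + C (a - b) : L[X]).support ⊆ {0, 1} := by
    intro i hi
    by_contra hni
    simp only [Finset.mem_insert, Finset.mem_singleton, not_or] at hni
    exact mem_support_iff.1 hi (by simp [coeff_X, coeff_C, hni.1, Ne.symm hni.2])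
  rw [monomialValue, ht]
  apply le_antisymm
  · refine Finset.sup_le fun i hi => ?_
    have := hd hi
    simp only [Finset.mem_insert, Finset.mem_singleton] at this
    rcases this with rfl | rfl
    · simp
    · simp
  · refine max_le ?_ ?_
    · have := Finset.le_sup (f := fun i => u ((X + C (a - b)).coeff i) * γ ^ i)
        (show 1 ∈ (X + C (a - b) : L[X]).support by simp)
      simpa using this
    · by_cases hab : a - b = 0
      · rw [hab, map_zero]
        exact zero_le
      · have := Finset.le_sup (f := fun i => u ((X + C (a - b)).coeff i) * γ ^ i)
          (show 0 ∈ (X + C (a - b) : L[X]).support by simpa using hab)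
        simpa using this

/-- Every `x - b` has value `max γ (W (a - b))`, which is just `γ` at `b = a`. -/
lemma IsPairOfDefinition.val_X_sub_C_le {a : L} {γ : Γ} (h : IsPairOfDefinition w vbar W a γ)
    (b : L) : W (RatFunc.X - RatFunc.C a) ≤ W (RatFunc.X - RatFunc.C b) := by
  have hval : ∀ c, W (RatFunc.X - RatFunc.C c) = max γ (W (RatFunc.C (a - c))) := fun c => by
    have := h.eq_monomialValue (X - C c)
    rw [monomialValue_X_sub_C] at this
    simpa only [map_sub, RatFunc.algebraMap_X, RatFunc.algebraMap_C, Valuation.comap_apply,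
      RatFunc.algebraMap_eq_C] using this
  rw [hval a, hval b, sub_self, map_zero, map_zero, max_eq_left zero_le]
  exact le_max_left _ _

end Immediate

end ValTransc

theorem corollary3p13 {K Kbar Γ₀ Γ₁ Γ₂ : Type*} [Field K] [Field Kbar] [Algebra K Kbar]
    [IsAlgClosure K Kbar]
    [LinearOrderedCommGroupWithZero Γ₀] [LinearOrderedCommGroupWithZero Γ₁]
    [LinearOrderedCommGroupWithZero Γ₂]
    (v : Valuation K Γ₀) (w : Valuation (RatFunc K) Γ₁) [v.HasExtension w]
    (hw : ValTransc.IsValuationTranscendental v w)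
    (vbar : Valuation Kbar Γ₂) [v.HasExtension vbar] :
    (ValTransc.commonExtensions w vbar).Finite ∧
      ∀ {Γ : Type*} [LinearOrderedCommGroupWithZero Γ] (W : Valuation (RatFunc Kbar) Γ)
        (a : Kbar) (γ : Γ), ValTransc.IsMinimalPairOfDefinition w vbar W a γ →
        (ValTransc.commonExtensions w vbar).ncard ≤
          Module.finrank K (IntermediateField.adjoin K {a}) := by
  have : IsAlgClosed Kbar := IsAlgClosure.isAlgClosed K
  have : Algebra.IsAlgebraic K Kbar := IsAlgClosure.isAlgebraic
  refine ⟨?_, fun W a γ h => ?_⟩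
  -- Any one common extension, if there is one, supplies an `a` that bounds the number of all of
  -- them.
  · rcases (ValTransc.commonExtensions w vbar).eq_empty_or_nonempty with h | ⟨O, hO⟩
    · rw [h]
      exact Set.finite_empty
    · have hO' : ValTransc.IsCommonExtension w vbar O.valuation := hO
      obtain ⟨a, ha⟩ := hO'.exists_minimal hw
      exact (hO'.finite_and_ncard_le ha).1
  · exact (h.isPairOfDefinition.isCommonExtension.finite_and_ncard_le
      h.isPairOfDefinition.val_X_sub_C_le).2
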